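/- Let $\mathbb B_3$ be the blow-up of $\mathbb P^2_{\mathbb C}$ at three non-collinear points, with exceptional curves $E_1,E_2,E_3$, let $H$ be the strict transform of a line missing the three points, and let $L_1$ be the strict transform of the line through the points under $E_2$ and $E_3$, so that $L_1\sim H-E_2-E_3$. Explicitly, $\mathbb B_3=(\mathbb C^6\setminus W)/(\mathbb C^\times)^4$, where $(\mathbb C^\times)^4$ acts on the coordinates $X,Y,Z,s,t,u$ of $\mathbb C^6$ with weights $(1,1,0,1)$, $(1,0,1,1)$, $(1,1,1,0)$, $(0,-1,0,0)$, $(0,0,-1,0)$, $(0,0,0,-1)$, and $W$ is the union of the nine subspaces $X=t=0$, $Y=s=0$, $Z=u=0$, $X=Y=0$, $Y=Z=0$, $Z=X=0$, $s=t=0$, $u=t=0$, $s=u=0$; here $L_1=\{X=0\}$, $E_1=\{t=0\}$, $E_2=\{s=0\}$, $E_3=\{u=0\}$, and the blow-down to $\mathbb P^2$ is $(Xsu,Ytu,Zst)$. Identify $\operatorname{Pic}\mathbb B_3$ with $\mathbb Z^4$ by the ordered basis $H,-E_2,-E_1,-E_3$, and let $\theta:\mathbb Z^4\to\mathbb Z^4$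 be left multiplication by $$\begin{pmatrix}2&-1&-1&-1\\1&-1&-1&0\\1&0&-1&-1\\1&-1&0&-1\end{pmatrix}.$$ Let $D_0=0$, let $D_1=(1,1,0,1)$ be the class of $L_1$, and let $D_n=(1+\theta+\cdots+\theta^{n-1})(D_1)$ for $n\ge1$. Write $h^0(D)=\dim_{\mathbb C}H^0(\mathbb B_3,\mathcal O(D))$. Then for all integers $m\ge 0$ and $0\le r\le 5$, $$h^0(D_{6m+r})=\begin{cases}(m+1)(3m+r)&\text{if } r\ne0,\\ 3m^2+3m+1&\text{if } r=0,\end{cases}$$ and, as formal power series, $$\sum_{n=0}^\infty h^0(D_n)\,t^n=\frac1{(1-t)(1-t^2)(1-t^3)}.$$ -/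

import Mathlib

/-! The third del Pezzo surface over `ℂ`, presented as the orbit space `(ℂ⁶ - W) / (ℂˣ)⁴`, with its
Zariski topology, its regular functions, its divisors and the spaces `H⁰(O(D))`. -/

namespace DelPezzo

/-- Polynomials in the six coordinates `X, Y, Z, s, t, u`, numbered `0, 1, 2, 3, 4, 5`. -/
abbrev Poly : Type := MvPolynomial (Fin 6) ℂ

/-- The weights of the action of `(ℂˣ)⁴` on the coordinates `X, Y, Z, s, t, u`. -/
def weight : Fin 6 → Fin 4 → ℤ :=
  ![![1, 1, 0, 1], ![1, 0, 1, 1], ![1, 1, 1, 0],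
    ![0, -1, 0, 0], ![0, 0, -1, 0], ![0, 0, 0, -1]]

/-- The pairs of coordinates whose common zero loci make up the irrelevant locus: `Xt`, `Ys`, `Zu`;
`XY`, `YZ`, `ZX`; `st`, `ut`, `su`. -/
def irrelevantPairs : Finset (Fin 6 × Fin 6) :=
  {(0, 4), (1, 3), (2, 5), (0, 1), (1, 2), (2, 0), (3, 4), (5, 4), (3, 5)}

/-- The irrelevant locus `W`, a union of nine subspaces of codimension two. -/
def irrelevantLocus : Set (Fin 6 → ℂ) :=
  {p | ∃ ij ∈ irrelevantPairs, p ij.1 = 0 ∧ p ij.2 = 0}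

/-- The points of `ℂ⁶ - W`. -/
structure Pt where
  coord : Fin 6 → ℂ
  not_mem : coord ∉ irrelevantLocus

/-- The torus `(ℂˣ)⁴`. -/
abbrev Torus : Type := Fin 4 → ℂˣ

/-- The character of the torus given by the exponent vector `w`. -/
def character (w : Fin 4 → ℤ) (g : Torus) : ℂˣ := ∏ j, g j ^ w j

theorem character_one (w : Fin 4 → ℤ) : character w 1 = 1 := by
  simp [character]

theorem character_mul (w : Fin 4 → ℤ) (g h : Torus) :
    character w (g * h) = character w g * character w h := by
  simp [character, mul_zpow, Finset.prod_mul_distrib]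

instance : MulAction Torus Pt where
  smul g p := ⟨fun i => character (weight i) g * p.coord i, by
    rintro ⟨ij, hij, h1, h2⟩
    exact p.not_mem ⟨ij, hij, by simpa using h1, by simpa using h2⟩⟩
  one_smul p := by
    cases p
    simp [HSMul.hSMul, character_one]
  mul_smul g h p := by
    cases p
    simp [HSMul.hSMul, character_mul, mul_assoc]

/-- The Zariski topology of `ℂ⁶ - W`. -/
instance : TopologicalSpace Pt :=
  TopologicalSpace.generateFrom
    {U | ∃ F : Poly, U = {p : Pt | MvPolynomial.eval p.coord F ≠ 0}}

/-- The surface `𝔹₃`, the orbit space of `ℂ⁶ - W` under the torus. -/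
def B3 : Type := MulAction.orbitRel.Quotient Torus Pt

/-- The quotient map `ℂ⁶ - W → 𝔹₃`. -/
def proj (p : Pt) : B3 := Quotient.mk (MulAction.orbitRel Torus Pt) p

/-- The Zariski topology of `𝔹₃` is the quotient topology. -/
instance : TopologicalSpace B3 := TopologicalSpace.coinduced proj inferInstance

/-- The function `f` is regular on the open subset `V` of `𝔹₃`: its pullback to `ℂ⁶ - W` is, near
each point over `V`, a quotient of polynomials. The values of `f` outside `V` play no role. -/
def IsRegularOn (V : Set B3) (f : B3 → ℂ) : Prop :=
  ∀ p : Pt, proj p ∈ V → ∃ F G : Poly, MvPolynomial.eval p.coord G ≠ 0 ∧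
    ∀ q : Pt, proj q ∈ V → MvPolynomial.eval q.coord G ≠ 0 →
      f (proj q) = MvPolynomial.eval q.coord F / MvPolynomial.eval q.coord G

/-- Seven curves on `𝔹₃`: the exceptional curves `E₁, E₂, E₃`, the strict transforms `L₁, L₂, L₃` of
the lines through two of the points blown up, and the strict transform `H` of a line that misses
these points. -/
inductive Curve where
  | H | E1 | E2 | E3 | L1 | L2 | L3
  deriving DecidableEq

instance : Fintype Curve where
  elems := {.H, .E1, .E2, .E3, .L1, .L2, .L3}
  complete C := by cases C <;> decide

open MvPolynomial in
/-- The equations of the curves. In the coordinates `Xsu, Ytu, Zst` of the plane, `H` is the strict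
transform of the line on which the sum of the coordinates vanishes. -/
noncomputable def Curve.equation : Curve → Poly
  | .H => X 0 * X 3 * X 5 + X 1 * X 4 * X 5 + X 2 * X 3 * X 4
  | .E1 => X 4
  | .E2 => X 3
  | .E3 => X 5
  | .L1 => X 0
  | .L2 => X 1
  | .L3 => X 2

/-- A curve as a subset of `𝔹₃`. -/
def Curve.carrier (C : Curve) : Set B3 :=
  {x | ∃ p : Pt, proj p = x ∧ MvPolynomial.eval p.coord C.equation = 0}

/-- The class of a curve in `Pic 𝔹₃ = ℤ⁴`, in the basis `H, -E₂, -E₁, -E₃`. Here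
`L₁ = H - E₂ - E₃`, `L₂ = H - E₁ - E₃` and `L₃ = H - E₁ - E₂`. -/
def Curve.cls : Curve → Fin 4 → ℤ
  | .H => ![1, 0, 0, 0]
  | .E1 => ![0, 0, -1, 0]
  | .E2 => ![0, -1, 0, 0]
  | .E3 => ![0, 0, 0, -1]
  | .L1 => ![1, 1, 0, 1]
  | .L2 => ![1, 0, 1, 1]
  | .L3 => ![1, 1, 1, 0]

/-- The function `g` is a local equation of the curve `C` on the open set `V`: it is regular on `V`,
and at each point of `V` its germ generates the ideal of germs of regular functions that vanish
on `C`. -/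
def IsLocalEquation (V : Set B3) (C : Curve) (g : B3 → ℂ) : Prop :=
  IsRegularOn V g ∧ (∀ x ∈ V ∩ C.carrier, g x = 0) ∧
    ∀ x ∈ V, ∀ V' : Set B3, IsOpen V' → x ∈ V' → ∀ f : B3 → ℂ, IsRegularOn V' f →
      (∀ y ∈ V' ∩ C.carrier, f y = 0) →
      ∃ V'' : Set B3, IsOpen V'' ∧ x ∈ V'' ∧ V'' ⊆ V ∩ V' ∧
        ∃ k : B3 → ℂ, IsRegularOn V'' k ∧ ∀ y ∈ V'', f y = g y * k y

/-- Divisors supported on the seven curves. -/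
abbrev Divisor : Type := Curve → ℤ

/-- The class of a divisor in `Pic 𝔹₃ = ℤ⁴`. -/
def Divisor.cls (D : Divisor) : Fin 4 → ℤ := ∑ C, D C • C.cls

/-- The dense open complement of the seven curves. -/
def offCurves : Set B3 := {x | ∀ C : Curve, x ∉ C.carrier}

theorem IsRegularOn.zero (V : Set B3) : IsRegularOn V 0 :=
  fun _ _ => ⟨0, 1, by simp, by simp⟩

theorem IsRegularOn.smul {V : Set B3} {f : B3 → ℂ} (c : ℂ) (hf : IsRegularOn V f) :
    IsRegularOn V (c • f) := by
  intro p hp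
  obtain ⟨F, G, hG, h⟩ := hf p hp
  refine ⟨MvPolynomial.C c * F, G, hG, fun q hq hGq => ?_⟩
  simp [h q hq hGq, mul_div_assoc]

theorem IsRegularOn.add {V : Set B3} {f g : B3 → ℂ} (hf : IsRegularOn V f)
    (hg : IsRegularOn V g) : IsRegularOn V (f + g) := by
  intro p hp
  obtain ⟨F, G, hG, h⟩ := hf p hp
  obtain ⟨F', G', hG', h'⟩ := hg p hp
  refine ⟨F * G' + G * F', G * G', by simp [hG, hG'], fun q hq hGq => ?_⟩
  simp only [map_mul, ne_eq, mul_eq_zero, not_or] at hGq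
  simp only [Pi.add_apply, h q hq hGq.1, h' q hq hGq.2, map_add, map_mul]
  exact div_add_div _ _ hGq.1 hGq.2

theorem IsRegularOn.mono {V V' : Set B3} {f : B3 → ℂ} (hf : IsRegularOn V f) (hV : V' ⊆ V) :
    IsRegularOn V' f := by
  intro p hp
  obtain ⟨F, G, hG, h⟩ := hf p (hV hp)
  exact ⟨F, G, hG, fun q hq => h q (hV hq)⟩

/-- `H⁰(𝔹₃, O(D))`: the rational functions `f` such that `f · ∏ g_C ^ D(C)` is regular on `V`
whenever the `g_C` are local equations of the curves on `V`. Such an `f` is regular off the curves;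
it is represented by its values there, extended by `0`. -/
def sections (D : Divisor) : Submodule ℂ (B3 → ℂ) where
  carrier := {f | (∀ x ∉ offCurves, f x = 0) ∧ IsRegularOn offCurves f ∧
    ∀ (V : Set B3) (g : Curve → B3 → ℂ), IsOpen V → (∀ C, IsLocalEquation V C (g C)) →
      ∀ x ∈ V, ∃ V' : Set B3, IsOpen V' ∧ x ∈ V' ∧ V' ⊆ V ∧
        ∃ k : B3 → ℂ, IsRegularOn V' k ∧
          ∀ y ∈ V' ∩ offCurves, k y = f y * ∏ C, g C y ^ D C}
  zero_mem' := by
    refine ⟨fun _ _ => rfl, .zero _, fun V g hV _ x hx => ⟨V, hV, hx, subset_rfl, 0, .zero _, ?_⟩⟩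
    simp
  add_mem' := by
    rintro a b ⟨ha0, ha1, ha⟩ ⟨hb0, hb1, hb⟩
    refine ⟨fun x hx => by simp [ha0 x hx, hb0 x hx], ha1.add hb1, fun V g hV hg x hx => ?_⟩
    obtain ⟨A, hA, hxA, hAV, k, hk, hka⟩ := ha V g hV hg x hx
    obtain ⟨B, hB, hxB, hBV, l, hl, hlb⟩ := hb V g hV hg x hx
    refine ⟨A ∩ B, hA.inter hB, ⟨hxA, hxB⟩, Set.inter_subset_left.trans hAV, k + l,
      (hk.mono Set.inter_subset_left).add (hl.mono Set.inter_subset_right), ?_⟩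
    rintro y ⟨⟨hyA, hyB⟩, hy⟩
    simp only [Pi.add_apply, hka y ⟨hyA, hy⟩, hlb y ⟨hyB, hy⟩, add_mul]
  smul_mem' := by
    rintro c a ⟨ha0, ha1, ha⟩
    refine ⟨fun x hx => by simp [ha0 x hx], ha1.smul c, fun V g hV hg x hx => ?_⟩
    obtain ⟨A, hA, hxA, hAV, k, hk, hka⟩ := ha V g hV hg x hx
    refine ⟨A, hA, hxA, hAV, c • k, hk.smul c, fun y hy => ?_⟩
    simp only [Pi.smul_apply, smul_eq_mul, hka y hy, mul_assoc]

/-- `h⁰(D) = dim H⁰(𝔹₃, O(D))`. -/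
noncomputable def h0 (D : Divisor) : ℕ := Module.finrank ℂ (sections D)

/-- The action on `Pic 𝔹₃ = ℤ⁴` of the automorphism of order six. -/
def theta : Matrix (Fin 4) (Fin 4) ℤ :=
  !![2, -1, -1, -1; 1, -1, -1, 0; 1, 0, -1, -1; 1, -1, 0, -1]

/-- The class `D_n = (1 + θ + ⋯ + θ ^ (n - 1)) D₁`, where `D₁` is the class of the line `L₁`. -/
def classD (n : ℕ) : Fin 4 → ℤ := (∑ i ∈ Finset.range n, theta ^ i).mulVec Curve.L1.cls

end DelPezzo

/-! The ring of polynomials in the six coordinates is the Cox ring of the surface: `H⁰(O(D))` is its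
graded piece of weight `D.cls`, so `h⁰(D)` counts monomials of that weight.

The isomorphism sends `F` to `F / ∏ C.equation ^ D C`. Every point has a chart on which each
equation, corrected by a Laurent monomial in nonvanishing coordinates, becomes invariant and is a
local equation of its curve (`exists_exponent`, `isLocalEquation_chart`); hence the quotient is a
section. Conversely, for a section `f` the product `f · ∏ C.equation ^ D C` is locally a quotient of
polynomials on `ℂ⁶ - W`. Unique factorization makes it one global quotient `A / B`, and `B` is
constant because `W` has codimension two. Invariance of `f` makes the resulting polynomial
homogeneous.

A monomial of weight `(a, b, c, d)` is a plane monomial of degree `a` outside three corner triangles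
with `b(b+1)/2`, `c(c+1)/2`, `d(d+1)/2` points. When these triangles are disjoint the count is
quadratic (`card_monomials`). Since `θ⁶ = 1` and `D₆ = (3, 1, 1, 1) = -K`, one has `D_{6m+r} = -mK +
D_r`, and six base cases give the formula. The series follows from the linear recurrence encoded by
the denominator. -/

namespace DelPezzo

open MvPolynomial

/-! ### The torus action and semi-invariant polynomials -/

theorem coord_smul (g : Torus) (p : Pt) (i : Fin 6) :
    (g • p).coord i = character (weight i) g * p.coord i := rfl

theorem coord_smul_ne_zero (g : Torus) (p : Pt) (i : Fin 6) :
    (g • p).coord i ≠ 0 ↔ p.coord i ≠ 0 := by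
  simp [coord_smul]

theorem proj_smul (g : Torus) (p : Pt) : proj (g • p) = proj p :=
  Quotient.sound (s := MulAction.orbitRel Torus Pt) ⟨g, rfl⟩

theorem exists_smul_of_proj_eq {p q : Pt} (h : proj p = proj q) : ∃ g : Torus, p = g • q := by
  obtain ⟨g, hg⟩ := Quotient.exact (s := MulAction.orbitRel Torus Pt) h
  exact ⟨g, hg.symm⟩

theorem proj_surjective : Function.Surjective proj := Quotient.mk_surjective

theorem character_zero (g : Torus) : character 0 g = 1 := by simp [character]

theorem character_add (w w' : Fin 4 → ℤ) (g : Torus) :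
    character (w + w') g = character w g * character w' g := by
  simp [character, zpow_add, Finset.prod_mul_distrib]

theorem character_neg (w : Fin 4 → ℤ) (g : Torus) :
    character (-w) g = (character w g)⁻¹ := by
  simp [character]

theorem character_zsmul (n : ℤ) (w : Fin 4 → ℤ) (g : Torus) :
    character (n • w) g = character w g ^ n := by
  simp only [character, Pi.smul_apply, smul_eq_mul, ← Finset.prod_zpow]
  exact Finset.prod_congr rfl fun j _ => by rw [mul_comm, zpow_mul]

theorem character_sum {ι : Type*} (s : Finset ι) (n : ι → ℤ) (w : ι → Fin 4 → ℤ) (g : Torus) :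
    character (∑ i ∈ s, n i • w i) g = ∏ i ∈ s, character (w i) g ^ n i := by
  classical
  induction s using Finset.induction_on with
  | empty => simp [character_zero]
  | insert a s ha ih =>
    rw [Finset.sum_insert ha, Finset.prod_insert ha, character_add, character_zsmul, ih]

/-- A weight is determined by its character. -/
theorem eq_of_character_eq {w w' : Fin 4 → ℤ} (h : ∀ g, character w g = character w' g) :
    w = w' := by
  funext j
  have h2 : (2 : ℂ) ≠ 0 := two_ne_zero
  have key : ∀ v : Fin 4 → ℤ,
      ((character v (Function.update 1 j (Units.mk0 2 h2)) : ℂˣ) : ℂ) = 2 ^ v j := by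
    intro v
    rw [character, Finset.prod_eq_single j]
    · simp
    · intro b _ hb
      simp [Function.update_of_ne hb]
    · simp
  -- Injectivity of `n ↦ 2 ^ n` needs an ordered field, hence the passage to `ℝ`.
  have h3 : ((2 : ℝ) : ℂ) ^ w j = ((2 : ℝ) : ℂ) ^ w' j := by
    have := key w
    rw [h, key w'] at this
    simpa using this.symm
  have h4 : (2 : ℝ) ^ w j = (2 : ℝ) ^ w' j := by exact_mod_cast h3
  exact zpow_right_injective₀ (by norm_num) (by norm_num) h4

theorem character_finsupp_weight (d : Fin 6 →₀ ℕ) (g : Torus) :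
    character (Finsupp.weight weight d) g = ∏ i, character (weight i) g ^ d i := by
  have : Finsupp.weight weight d = ∑ i, (d i : ℤ) • weight i := by
    rw [Finsupp.weight_apply, Finsupp.sum_fintype _ _ (by simp)]
    simp
  rw [this, character_sum]
  simp

/-- The pullback of a polynomial under the action of a torus element. -/
noncomputable def twist (g : Torus) : Poly →ₐ[ℂ] Poly :=
  aeval fun i => C (character (weight i) g : ℂ) * X i

theorem eval_twist (g : Torus) (p : Pt) (F : Poly) :
    eval p.coord (twist g F) = eval (g • p).coord F := by
  induction F using MvPolynomial.induction_on with
  | C a => simp [twist]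
  | add F G hF hG => simp [hF, hG]
  | mul_X F i hF =>
    rw [map_mul, map_mul, hF, map_mul, eval_X, coord_smul, twist, aeval_X, map_mul, eval_C, eval_X]

theorem coeff_twist (g : Torus) (F : Poly) (d : Fin 6 →₀ ℕ) :
    coeff d (twist g F) = character (Finsupp.weight weight d) g * coeff d F := by
  classical
  induction F using MvPolynomial.induction_on' with
  | add F G hF hG => simp [hF, hG, mul_add]
  | monomial e a =>
    have : twist g (monomial e a) =
        monomial e ((character (Finsupp.weight weight e) g : ℂ) * a) := by
      rw [twist, aeval_monomial, Finsupp.prod_fintype _ _ (by simp), character_finsupp_weight,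
        mul_comm _ a, ← C_mul_monomial, monomial_eq, Finsupp.prod_fintype _ _ (by simp)]
      simp [mul_pow, Finset.prod_mul_distrib]
    rw [this, coeff_monomial, coeff_monomial]
    split_ifs with h
    · rw [h]
    · simp

/-- Distinct weights have distinct characters, so homogeneity can be tested on the torus action. -/
theorem isWeightedHomogeneous_iff_twist {F : Poly} {w : Fin 4 → ℤ} :
    IsWeightedHomogeneous weight F w ↔ ∀ g, twist g F = C (character w g : ℂ) * F := by
  constructor
  · intro h g
    ext d
    rw [coeff_twist, coeff_C_mul]
    by_cases hd : coeff d F = 0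
    · simp [hd]
    · rw [h hd]
  · intro h d hd
    refine eq_of_character_eq fun g => ?_
    have := congrArg (coeff d) (h g)
    rw [coeff_twist, coeff_C_mul] at this
    exact Units.ext (mul_right_cancel₀ hd this)

theorem eval_smul_of_isWeightedHomogeneous {F : Poly} {w : Fin 4 → ℤ}
    (h : IsWeightedHomogeneous weight F w) (g : Torus) (p : Pt) :
    eval (g • p).coord F = character w g * eval p.coord F := by
  rw [← eval_twist, isWeightedHomogeneous_iff_twist.1 h g]
  simp

/-! ### Density and the Zariski topology -/

/-- Polynomials that agree on a nonempty principal open subset of `ℂ⁶ - W` are equal. -/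
theorem eq_of_eval_eq {N F G : Poly} (hN : N ≠ 0)
    (h : ∀ q : Pt, eval q.coord N ≠ 0 → eval q.coord F = eval q.coord G) : F = G := by
  have hX : (∏ i : Fin 6, X i : Poly) ≠ 0 := Finset.prod_ne_zero_iff.2 fun i _ => X_ne_zero i
  -- `W` lies in the union of the coordinate hyperplanes, so this multiple vanishes on all of `ℂ⁶`.
  have : (F - G) * (N * ∏ i : Fin 6, X i) = 0 := by
    apply MvPolynomial.funext
    intro x
    by_cases hx : eval x (N * ∏ i : Fin 6, X i) = 0
    · rw [map_mul, hx, mul_zero, map_zero]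
    · have hx' := hx
      rw [map_mul, map_prod, mul_eq_zero, not_or, Finset.prod_eq_zero_iff] at hx
      simp only [Finset.mem_univ, true_and, eval_X, not_exists] at hx
      have := h ⟨x, by rintro ⟨ij, -, h1, -⟩; exact hx.2 _ h1⟩ hx.1
      rw [map_mul, map_sub, sub_eq_zero.2 this, zero_mul, map_zero]
  exact sub_eq_zero.1 ((mul_eq_zero.1 this).resolve_right (mul_ne_zero hN hX))

theorem ne_zero_of_eval_ne_zero {x : Fin 6 → ℂ} {F : Poly} (h : eval x F ≠ 0) : F ≠ 0 := by
  rintro rfl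
  simp at h

theorem exists_principal_open_subset {U : Set Pt} (hU : IsOpen U) :
    ∀ p ∈ U, ∃ N : Poly, eval p.coord N ≠ 0 ∧ ∀ q : Pt, eval q.coord N ≠ 0 → q ∈ U := by
  induction hU with
  | basic s hs =>
    obtain ⟨F, rfl⟩ := hs
    exact fun p hp => ⟨F, hp, fun q hq => hq⟩
  | univ => exact fun p _ => ⟨1, by simp, fun q _ => trivial⟩
  | inter s t _ _ ihs iht =>
    intro p hp
    obtain ⟨M, hM, hM'⟩ := ihs p hp.1
    obtain ⟨N, hN, hN'⟩ := iht p hp.2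
    refine ⟨M * N, by simp [hM, hN], fun q hq => ?_⟩
    rw [map_mul, mul_ne_zero_iff] at hq
    exact ⟨hM' q hq.1, hN' q hq.2⟩
  | sUnion S _ ih =>
    rintro p ⟨s, hs, hp⟩
    obtain ⟨N, hN, hN'⟩ := ih s hs p hp
    exact ⟨N, hN, fun q hq => ⟨s, hs, hN' q hq⟩⟩

theorem isOpen_of_preimage_eq {V : Set B3} (F : Poly)
    (h : ∀ p, proj p ∈ V ↔ eval p.coord F ≠ 0) : IsOpen V := by
  refine isOpen_coinduced.2 (TopologicalSpace.isOpen_generateFrom_of_mem ⟨F, ?_⟩)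
  ext p
  exact h p

theorem exists_principal_open_subset_preimage {V : Set B3} (hV : IsOpen V) {p : Pt}
    (hp : proj p ∈ V) :
    ∃ N : Poly, eval p.coord N ≠ 0 ∧ ∀ q : Pt, eval q.coord N ≠ 0 → proj q ∈ V :=
  exists_principal_open_subset (isOpen_coinduced.1 hV) p hp

/-- A function that is locally a quotient of polynomials is globally the quotient of two coprime
polynomials. Here the function only matters where `T` does not vanish. -/
theorem exists_quotient_of_locally_quotient (S : Set Pt) (φ : Pt → ℂ) {T : Poly} (hT : T ≠ 0)
    (h : ∀ p ∈ S, ∃ F G : Poly, eval p.coord G ≠ 0 ∧ ∀ q : Pt, eval q.coord G ≠ 0 →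
      eval q.coord T ≠ 0 → φ q = eval q.coord F / eval q.coord G) :
    ∃ A B : Poly, ∀ p ∈ S, eval p.coord B ≠ 0 ∧
      (eval p.coord T ≠ 0 → φ p = eval p.coord A / eval p.coord B) := by
  rcases S.eq_empty_or_nonempty with rfl | ⟨p₀, hp₀⟩
  · exact ⟨0, 0, by simp⟩
  obtain ⟨F₀, G₀, hG₀, h₀⟩ := h p₀ hp₀
  have hG₀' := ne_zero_of_eval_ne_zero hG₀
  obtain ⟨B, A, D, hrel, rfl, rfl⟩ := UniqueFactorizationMonoid.exists_reduced_factors G₀ hG₀' F₀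
  have hD : D ≠ 0 := left_ne_zero_of_mul hG₀'
  refine ⟨A, B, fun p hp => ?_⟩
  obtain ⟨F, G, hG, hFG⟩ := h p hp
  -- Nonempty principal open sets meet, so every other local quotient `F / G` equals `A / B`;
  -- coprimality then forces `B ∣ G`, and `B` cannot vanish where `G` does not.
  have key : A * G = F * B := by
    refine eq_of_eval_eq (N := T * (D * B * G))
      (mul_ne_zero hT (mul_ne_zero hG₀' (ne_zero_of_eval_ne_zero hG))) fun q hq => ?_
    simp only [map_mul, mul_ne_zero_iff] at hq
    obtain ⟨hqT, ⟨hqD, hqB⟩, hqG⟩ := hq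
    have e := (h₀ q (by simp [hqD, hqB]) hqT).symm.trans (hFG q hqG hqT)
    simp only [map_mul] at e ⊢
    rw [mul_div_mul_left _ _ hqD, div_eq_div_iff hqB hqG] at e
    exact e
  have hB : eval p.coord B ≠ 0 := by
    obtain ⟨K, hK⟩ := hrel.dvd_of_dvd_mul_left (show B ∣ A * G from key ▸ dvd_mul_left B F)
    intro h0
    rw [hK, map_mul, h0, zero_mul] at hG
    exact hG rfl
  refine ⟨hB, fun hpT => ?_⟩
  rw [hFG p hG hpT, div_eq_div_iff hG hB, ← map_mul, ← map_mul, key]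

theorem IsRegularOn.exists_quotient {V : Set B3} (hV : IsOpen V) {f : B3 → ℂ}
    (hf : IsRegularOn V f) : ∃ A B : Poly, ∀ p, proj p ∈ V → eval p.coord B ≠ 0 ∧
      f (proj p) = eval p.coord A / eval p.coord B := by
  obtain ⟨A, B, h⟩ := exists_quotient_of_locally_quotient (proj ⁻¹' V) (fun p => f (proj p))
    (T := 1) one_ne_zero (by
      intro p hp
      obtain ⟨F, G, hG, hFG⟩ := hf p hp
      obtain ⟨N, hN, hNV⟩ := exists_principal_open_subset_preimage hV hp
      refine ⟨F * N, G * N, by simp [hG, hN], fun q hq _ => ?_⟩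
      rw [map_mul, mul_ne_zero_iff] at hq
      rw [hFG q (hNV q hq.2) hq.1, map_mul, map_mul, mul_div_mul_right _ _ hq.2])
  exact ⟨A, B, fun p hp => ⟨(h p hp).1, (h p hp).2 (by simp)⟩⟩

theorem isRegularOn_of_quotient {V : Set B3} {f : B3 → ℂ} (A B : Poly)
    (h : ∀ p, proj p ∈ V → eval p.coord B ≠ 0 ∧ f (proj p) = eval p.coord A / eval p.coord B) :
    IsRegularOn V f :=
  fun p hp => ⟨A, B, (h p hp).1, fun q hq _ => (h q hq).2⟩

theorem IsRegularOn.one (V : Set B3) : IsRegularOn V 1 :=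
  fun _ _ => ⟨1, 1, by simp, by simp⟩

theorem IsRegularOn.mul {V : Set B3} {f g : B3 → ℂ} (hf : IsRegularOn V f)
    (hg : IsRegularOn V g) : IsRegularOn V (f * g) := by
  intro p hp
  obtain ⟨F, G, hG, h⟩ := hf p hp
  obtain ⟨F', G', hG', h'⟩ := hg p hp
  refine ⟨F * F', G * G', by simp [hG, hG'], fun q hq hGq => ?_⟩
  rw [map_mul, mul_ne_zero_iff] at hGq
  rw [Pi.mul_apply, h q hq hGq.1, h' q hq hGq.2, map_mul, map_mul, div_mul_div_comm]

theorem IsRegularOn.pow {V : Set B3} {f : B3 → ℂ} (hf : IsRegularOn V f) (n : ℕ) :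
    IsRegularOn V (f ^ n) := by
  induction n with
  | zero => simpa using IsRegularOn.one V
  | succ n ih => simpa [pow_succ] using ih.mul hf

theorem IsRegularOn.prod {ι : Type*} {V : Set B3} (s : Finset ι) {f : ι → B3 → ℂ}
    (hf : ∀ i, IsRegularOn V (f i)) : IsRegularOn V (∏ i ∈ s, f i) := by
  classical
  induction s using Finset.induction_on with
  | empty => simpa using IsRegularOn.one V
  | insert a s ha ih => simpa [Finset.prod_insert ha] using (hf a).mul ih

/-- The function on `𝔹₃` given by the values of `φ` on representatives. -/
noncomputable def descend (φ : Pt → ℂ) (x : B3) : ℂ :=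
  φ (Function.surjInv proj_surjective x)

/-- Invariance is required along one orbit only, which allows `φ` to be invariant merely over an
open set. -/
theorem descend_proj {φ : Pt → ℂ} {p : Pt} (h : ∀ g : Torus, φ (g • p) = φ p) :
    descend φ (proj p) = φ p := by
  obtain ⟨g, hg⟩ := exists_smul_of_proj_eq (Function.surjInv_eq proj_surjective (proj p))
  rw [descend, hg, h]

/-! ### Laurent monomials and charts -/

/-- The value of a Laurent monomial in the six coordinates. -/
noncomputable def laurent (e : Fin 6 → ℤ) (p : Pt) : ℂ := ∏ i, p.coord i ^ e i

theorem laurent_smul (e : Fin 6 → ℤ) (g : Torus) (p : Pt) :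
    laurent e (g • p) = character (∑ i, e i • weight i) g * laurent e p := by
  rw [character_sum]
  simp [laurent, coord_smul, mul_zpow, Finset.prod_mul_distrib]

theorem laurent_ne_zero {e : Fin 6 → ℤ} {p : Pt} (h : ∀ i, e i ≠ 0 → p.coord i ≠ 0) :
    laurent e p ≠ 0 := by
  refine Finset.prod_ne_zero_iff.2 fun i _ => ?_
  by_cases hi : e i = 0
  · simp [hi]
  · exact zpow_ne_zero _ (h i hi)

theorem laurent_neg (e : Fin 6 → ℤ) (p : Pt) : laurent (-e) p = (laurent e p)⁻¹ := by
  simp [laurent]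

theorem laurent_sum {ι : Type*} (s : Finset ι) (n : ι → ℤ) (e : ι → Fin 6 → ℤ) {p : Pt}
    (h : ∀ j ∈ s, ∀ i, e j i ≠ 0 → p.coord i ≠ 0) :
    laurent (∑ j ∈ s, n j • e j) p = ∏ j ∈ s, laurent (e j) p ^ n j := by
  simp only [laurent, ← Finset.prod_zpow]
  rw [Finset.prod_comm]
  refine Finset.prod_congr rfl fun i _ => ?_
  by_cases hi : p.coord i = 0
  -- At a vanishing coordinate `z ^ (m + n) = z ^ m * z ^ n` can fail, but there all exponents are
  -- zero.
  · have : ∀ j ∈ s, e j i = 0 := fun j hj => by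
      by_contra hne
      exact h j hj i hne hi
    rw [Finset.sum_apply, Finset.sum_eq_zero, Finset.prod_eq_one, zpow_zero]
    · intro j hj
      simp [this j hj]
    · intro j hj
      simp [this j hj]
  · rw [Finset.sum_apply]
    clear h
    classical
    induction s using Finset.induction_on with
    | empty => simp
    | insert a s ha ih =>
      rw [Finset.sum_insert ha, Finset.prod_insert ha, zpow_add₀ hi, ih, Pi.smul_apply,
        smul_eq_mul, mul_comm (n a), zpow_mul]

/-- This includes `z = 0`: a negative power is then `0`, which is also `1 / 0`. -/
theorem zpow_eq_pow_div_pow (z : ℂ) (n : ℤ) : z ^ n = z ^ n.toNat / z ^ (-n).toNat := by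
  rcases le_total 0 n with h | h
  · obtain ⟨k, rfl⟩ := Int.eq_ofNat_of_zero_le h
    simp
  · obtain ⟨k, hk⟩ := Int.eq_ofNat_of_zero_le (neg_nonneg.2 h)
    obtain rfl : n = -k := by omega
    simp

theorem exists_laurent_eq_quotient (e : Fin 6 → ℤ) : ∃ P Q : Poly, ∀ p : Pt,
    laurent e p = eval p.coord P / eval p.coord Q ∧
      ((∀ i, e i ≠ 0 → p.coord i ≠ 0) → eval p.coord Q ≠ 0) := by
  refine ⟨∏ i, X i ^ (e i).toNat, ∏ i, X i ^ (-e i).toNat, fun p => ⟨?_, fun h => ?_⟩⟩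
  · simp only [laurent, map_prod, map_pow, eval_X, ← Finset.prod_div_distrib]
    exact Finset.prod_congr rfl fun i _ => zpow_eq_pow_div_pow _ _
  · simp only [map_prod, map_pow, eval_X]
    refine Finset.prod_ne_zero_iff.2 fun i _ => ?_
    by_cases hi : e i = 0
    · simp [hi]
    · exact pow_ne_zero _ (h i hi)

theorem exists_exponent_of_eq {p : Pt} {w : Fin 4 → ℤ} (a b c d k l : ℤ)
    (ha : a = 0 ∨ p.coord 0 ≠ 0) (hb : b = 0 ∨ p.coord 1 ≠ 0) (hc : c = 0 ∨ p.coord 2 ≠ 0)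
    (hd : d = 0 ∨ p.coord 3 ≠ 0) (hk : k = 0 ∨ p.coord 4 ≠ 0) (hl : l = 0 ∨ p.coord 5 ≠ 0)
    (h0 : a + b + c = w 0) (h1 : a + c - d = w 1) (h2 : b + c - k = w 2) (h3 : a + b - l = w 3) :
    ∃ e : Fin 6 → ℤ, ∑ i, e i • weight i = w ∧ ∀ i, e i ≠ 0 → p.coord i ≠ 0 := by
  refine ⟨![a, b, c, d, k, l], ?_, fun i => ?_⟩
  · funext j
    fin_cases j <;> simp [Fin.sum_univ_six, weight] <;> linarith
  · rw [← or_iff_not_imp_left]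
    fin_cases i
    exacts [ha, hb, hc, hd, hk, hl]

/-- At each point, every weight is the weight of a Laurent monomial in the coordinates that do not
vanish there. -/
theorem exists_exponent (p : Pt) (w : Fin 4 → ℤ) :
    ∃ e : Fin 6 → ℤ, ∑ i, e i • weight i = w ∧ ∀ i, e i ≠ 0 → p.coord i ≠ 0 := by
  have hp : ∀ i j, (i, j) ∈ irrelevantPairs ∨ (j, i) ∈ irrelevantPairs →
      p.coord i = 0 → p.coord j ≠ 0 := by
    rintro i j (hij | hij) hi hj
    exacts [p.not_mem ⟨(i, j), hij, hi, hj⟩, p.not_mem ⟨(j, i), hij, hj, hi⟩]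
  -- The six pairs of coordinates that may vanish together are the torus-fixed points. For each, the
  -- weights of the other four coordinates form a `ℤ`-basis of `ℤ⁴`, and the exponents solve the
  -- resulting unimodular system.
  by_cases c0 : p.coord 0 = 0
  · have h1 := hp 0 1 (by decide) c0
    have h2 := hp 0 2 (by decide) c0
    have h4 := hp 0 4 (by decide) c0
    by_cases c3 : p.coord 3 = 0
    · have h5 := hp 3 5 (by decide) c3
      exact exists_exponent_of_eq 0 (w 0 - w 1) (w 1) 0 (w 0 - w 2) (w 0 - w 1 - w 3)
        (.inl rfl) (.inr h1) (.inr h2) (.inl rfl) (.inr h4) (.inr h5)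
        (by ring) (by ring) (by ring) (by ring)
    · exact exists_exponent_of_eq 0 (w 3) (w 0 - w 3) (w 0 - w 3 - w 1) (w 0 - w 2) 0
        (.inl rfl) (.inr h1) (.inr h2) (.inr c3) (.inr h4) (.inl rfl)
        (by ring) (by ring) (by ring) (by ring)
  by_cases c1 : p.coord 1 = 0
  · have h2 := hp 1 2 (by decide) c1
    have h3 := hp 1 3 (by decide) c1
    by_cases c4 : p.coord 4 = 0
    · have h5 := hp 4 5 (by decide) c4
      exact exists_exponent_of_eq (w 0 - w 2) 0 (w 2) (w 0 - w 1) 0 (w 0 - w 2 - w 3)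
        (.inr c0) (.inl rfl) (.inr h2) (.inr h3) (.inl rfl) (.inr h5)
        (by ring) (by ring) (by ring) (by ring)
    · exact exists_exponent_of_eq (w 3) 0 (w 0 - w 3) (w 0 - w 1) (w 0 - w 3 - w 2) 0
        (.inr c0) (.inl rfl) (.inr h2) (.inr h3) (.inr c4) (.inl rfl)
        (by ring) (by ring) (by ring) (by ring)
  by_cases c4 : p.coord 4 = 0
  · have h3 := hp 4 3 (by decide) c4
    have h5 := hp 4 5 (by decide) c4
    exact exists_exponent_of_eq (w 0 - w 2) (w 2) 0 (w 0 - w 2 - w 1) 0 (w 0 - w 3)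
      (.inr c0) (.inr c1) (.inl rfl) (.inr h3) (.inl rfl) (.inr h5)
      (by ring) (by ring) (by ring) (by ring)
  by_cases c5 : p.coord 5 = 0
  · have h2 := hp 5 2 (by decide) c5
    have h3 := hp 5 3 (by decide) c5
    exact exists_exponent_of_eq (w 3) 0 (w 0 - w 3) (w 0 - w 1) (w 0 - w 3 - w 2) 0
      (.inr c0) (.inl rfl) (.inr h2) (.inr h3) (.inr c4) (.inl rfl)
      (by ring) (by ring) (by ring) (by ring)
  · exact exists_exponent_of_eq (w 1) (w 0 - w 1) 0 0 (w 0 - w 1 - w 2) (w 0 - w 3)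
      (.inr c0) (.inr c1) (.inl rfl) (.inl rfl) (.inr c4) (.inr c5)
      (by ring) (by ring) (by ring) (by ring)

/-- The open neighbourhood of `proj p` on which no coordinate vanishes that does not vanish
at `p`. -/
def chart (p : Pt) : Set B3 := {x | ∃ q, proj q = x ∧ ∀ i, p.coord i ≠ 0 → q.coord i ≠ 0}

theorem proj_mem_chart {p q : Pt} :
    proj q ∈ chart p ↔ ∀ i, p.coord i ≠ 0 → q.coord i ≠ 0 := by
  constructor
  · rintro ⟨q', hq', h⟩ i hi
    obtain ⟨g, rfl⟩ := exists_smul_of_proj_eq hq'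
    exact (coord_smul_ne_zero g q i).1 (h i hi)
  · exact fun h => ⟨q, rfl, h⟩

theorem isOpen_chart (p : Pt) : IsOpen (chart p) := by
  classical
  refine isOpen_of_preimage_eq (∏ i with p.coord i ≠ 0, X i) fun q => ?_
  rw [proj_mem_chart, map_prod, Finset.prod_ne_zero_iff]
  simp

theorem proj_mem_chart_self (p : Pt) : proj p ∈ chart p := proj_mem_chart.2 fun _ h => h

/-! ### The curves -/

theorem Curve.isWeightedHomogeneous_equation (C : Curve) :
    IsWeightedHomogeneous weight C.equation C.cls := by
  have hX : ∀ (i : Fin 6) (w : Fin 4 → ℤ), weight i = w →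
      IsWeightedHomogeneous weight (X i : Poly) w := fun i w h =>
    h ▸ isWeightedHomogeneous_X ℂ weight i
  cases C
  case H =>
    have hXXX : ∀ i j k : Fin 6, weight i + weight j + weight k = Curve.H.cls →
        IsWeightedHomogeneous weight (X i * X j * X k : Poly) Curve.H.cls := fun i j k h =>
      h ▸ ((hX i _ rfl).mul (hX j _ rfl)).mul (hX k _ rfl)
    exact ((hXXX 0 3 5 (by decide)).add (hXXX 1 4 5 (by decide))).add (hXXX 2 3 4 (by decide))
  all_goals exact hX _ _ (by decide)

/-- The equation of `H` has degree one in `X 0` with coprime coefficients, hence is irreducible. -/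
theorem Curve.prime_equation (C : Curve) : Prime C.equation := by
  cases C
  case H =>
    have hnd : ∀ (i : Fin 6) (x : Fin 6 → ℂ), x i = 0 →
        eval x (X 1 * X 4 * X 5 + X 2 * X 3 * X 4 : Poly) ≠ 0 →
        IsRelPrime (X i) (X 1 * X 4 * X 5 + X 2 * X 3 * X 4 : Poly) := by
      intro i x hi hx
      refine ((X_prime (R := ℂ) (i := i)).irreducible.isRelPrime_iff_not_dvd).2 ?_
      rintro ⟨K, hK⟩
      rw [hK, map_mul, eval_X, hi, zero_mul] at hx
      exact hx rfl
    have hirr : Irreducible ((X 3 * X 5) * X 0 + (X 1 * X 4 * X 5 + X 2 * X 3 * X 4) : Poly) := by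
      refine irreducible_mul_X_add _ _ 0 (mul_ne_zero (X_ne_zero _) (X_ne_zero _)) ?_ ?_ ?_
      · intro h
        have := vars_mul _ _ h
        simp [vars_X] at this
      · intro h
        rcases Finset.mem_union.1 (vars_add_subset _ _ h) with h | h <;>
        · rcases Finset.mem_union.1 (vars_mul _ _ h) with h | h
          · have := vars_mul _ _ h
            simp [vars_X] at this
          · simp [vars_X] at h
      · refine IsRelPrime.mul_left (hnd 3 ![0, 1, 1, 0, 1, 1] rfl ?_)
          (hnd 5 ![0, 1, 1, 1, 1, 0] rfl ?_) <;> simp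
    have : Curve.H.equation =
        (X 3 * X 5) * X 0 + (X 1 * X 4 * X 5 + X 2 * X 3 * X 4) := by
      rw [Curve.equation]
      ring
    rw [this]
    exact hirr.prime
  all_goals exact X_prime

theorem Curve.equation_ne_zero (C : Curve) : C.equation ≠ 0 := C.prime_equation.ne_zero

theorem Curve.proj_mem_carrier {C : Curve} {p : Pt} :
    proj p ∈ C.carrier ↔ eval p.coord C.equation = 0 := by
  constructor
  · rintro ⟨q, hq, h⟩
    obtain ⟨g, rfl⟩ := exists_smul_of_proj_eq hq
    rw [eval_smul_of_isWeightedHomogeneous C.isWeightedHomogeneous_equation] at h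
    simpa using h
  · exact fun h => ⟨p, rfl, h⟩

theorem proj_mem_offCurves {p : Pt} :
    proj p ∈ offCurves ↔ ∀ C : Curve, eval p.coord C.equation ≠ 0 :=
  forall_congr' fun _ => not_congr Curve.proj_mem_carrier

/-- The Nullstellensatz for a hypersurface. -/
theorem dvd_of_vanishing {P F : Poly} (hP : Prime P)
    (h : ∀ x, eval x P = 0 → eval x F = 0) : P ∣ F := by
  have hF : F ∈ vanishingIdeal ℂ (zeroLocus ℂ (Ideal.span {P})) := by
    intro x hx
    rw [zeroLocus_span] at hx
    have := h x (by simpa [aeval_eq_eval] using hx)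
    simpa [aeval_eq_eval] using this
  rw [vanishingIdeal_zeroLocus_eq_radical] at hF
  have hprime : (Ideal.span {P}).IsPrime := (Ideal.span_singleton_prime hP.ne_zero).2 hP
  rw [hprime.radical] at hF
  exact Ideal.mem_span_singleton.1 hF

/-- A polynomial without zeros in `ℂ⁶ - W` is constant. -/
theorem isUnit_of_forall_eval_ne_zero {B : Poly} (h : ∀ p : Pt, eval p.coord B ≠ 0) :
    IsUnit B := by
  by_contra hB
  have hB0 : B ≠ 0 := by
    rintro rfl
    exact h ⟨fun _ => 1, by simp [irrelevantLocus]⟩ (map_zero _)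
  obtain ⟨P, hirr, hPB⟩ := WfDvdMonoid.exists_irreducible_factor hB hB0
  have hP := hirr.prime
  have hW : ∀ x, eval x P = 0 → x ∈ irrelevantLocus := by
    intro x hx
    by_contra hxW
    obtain ⟨K, rfl⟩ := hPB
    exact h ⟨x, hxW⟩ (by simp [hx])
  -- If four coordinates meet every irrelevant pair, their product vanishes on `W`, so the prime `P`
  -- divides one of them.
  have hdvd : ∀ i j k l : Fin 6,
      (∀ ij ∈ irrelevantPairs, ij.1 ∈ [i, j, k, l] ∨ ij.2 ∈ [i, j, k, l]) →
      ∃ n ∈ [i, j, k, l], P ∣ X n := by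
    intro i j k l hijkl
    have : P ∣ X i * X j * X k * X l := dvd_of_vanishing hP fun x hx => by
      obtain ⟨ij, hij, h1, h2⟩ := hW x hx
      have : ∃ n ∈ [i, j, k, l], x n = 0 := by
        rcases hijkl ij hij with h | h
        exacts [⟨_, h, h1⟩, ⟨_, h, h2⟩]
      simpa [or_assoc] using this
    rcases hP.dvd_or_dvd this with h | h
    · rcases hP.dvd_or_dvd h with h | h
      · rcases hP.dvd_or_dvd h with h | h
        exacts [⟨i, by simp, h⟩, ⟨j, by simp, h⟩]
      · exact ⟨k, by simp, h⟩
    · exact ⟨l, by simp, h⟩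
  have huniq : ∀ m n : Fin 6, P ∣ X m → P ∣ X n → m = n := by
    intro m n hm hn
    have := (hirr.dvd_symm X_prime.irreducible hm).trans hn
    simpa using this
  obtain ⟨n, hn⟩ : ∃ n, P ∣ X n := by
    obtain ⟨n, -, hn⟩ := hdvd 1 2 4 5 (by decide)
    exact ⟨n, hn⟩
  have hall : ∀ i j k l : Fin 6,
      (∀ ij ∈ irrelevantPairs, ij.1 ∈ [i, j, k, l] ∨ ij.2 ∈ [i, j, k, l]) →
      n ∈ [i, j, k, l] := by
    intro i j k l hijkl
    obtain ⟨m, hm, hPm⟩ := hdvd i j k l hijkl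
    exact huniq m n hPm hn ▸ hm
  -- These three sets each meet all nine pairs but have no common element.
  have h1 := hall 1 2 4 5 (by decide)
  have h2 := hall 0 1 3 5 (by decide)
  have h3 := hall 0 2 3 4 (by decide)
  clear hall hn
  revert n
  decide

/-! ### Local equations of the curves -/

theorem descend_eval_mul_laurent {F : Poly} {w : Fin 4 → ℤ}
    (hF : IsWeightedHomogeneous weight F w) {e : Fin 6 → ℤ} (he : ∑ i, e i • weight i = -w)
    (q : Pt) : descend (fun q => eval q.coord F * laurent e q) (proj q) =
      eval q.coord F * laurent e q := by
  refine descend_proj fun g => ?_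
  rw [eval_smul_of_isWeightedHomogeneous hF, laurent_smul, he, character_neg,
    Units.val_inv_eq_inv_val]
  field_simp

theorem isRegularOn_descend_eval_mul_laurent {F : Poly} {w : Fin 4 → ℤ}
    (hF : IsWeightedHomogeneous weight F w) {e : Fin 6 → ℤ} (he : ∑ i, e i • weight i = -w)
    {p : Pt} (hp : ∀ i, e i ≠ 0 → p.coord i ≠ 0) :
    IsRegularOn (chart p) (descend fun q => eval q.coord F * laurent e q) := by
  obtain ⟨P, Q, hPQ⟩ := exists_laurent_eq_quotient e
  refine isRegularOn_of_quotient (F * P) Q fun q hq => ⟨(hPQ q).2 fun i hi => ?_, ?_⟩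
  · exact proj_mem_chart.1 hq i (hp i hi)
  · rw [descend_eval_mul_laurent hF he, (hPQ q).1, map_mul, mul_div_assoc]

/-- A regular function that vanishes on the curve `C` is a quotient whose numerator is divisible by
the equation of `C`. -/
theorem Curve.equation_dvd_of_vanishing {C : Curve} {V : Set B3} (hV : IsOpen V) {f : B3 → ℂ}
    (hfC : ∀ y ∈ V ∩ C.carrier, f y = 0) {A B : Poly}
    (hAB : ∀ p, proj p ∈ V → eval p.coord B ≠ 0 ∧
      f (proj p) = eval p.coord A / eval p.coord B)
    {p : Pt} (hp : proj p ∈ V) (hpC : eval p.coord C.equation = 0) : C.equation ∣ A := by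
  classical
  obtain ⟨N, hN, hNV⟩ := exists_principal_open_subset_preimage hV hp
  -- Where `R` does not vanish, a vector of `ℂ⁶` automatically avoids `W`, so the Nullstellensatz on
  -- `ℂ⁶` can be applied to `A * (N * R)`.
  set R : Poly := ∏ i with p.coord i ≠ 0, X i with hR
  have hRp : eval p.coord R ≠ 0 := by
    rw [hR, map_prod, Finset.prod_ne_zero_iff]
    simp
  have hdvd : C.equation ∣ A * (N * R) := by
    refine dvd_of_vanishing C.prime_equation fun x hx => ?_
    by_cases hNR : eval x (N * R) = 0
    · rw [map_mul, hNR, mul_zero]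
    · rw [map_mul, mul_eq_zero, not_or] at hNR
      have hxR : ∀ i, x i = 0 → p.coord i = 0 := by
        intro i hi
        by_contra hne
        exact hNR.2 (by
          rw [hR, map_prod]
          exact Finset.prod_eq_zero (i := i) (by simp [hne]) (by simp [hi]))
      let q : Pt := ⟨x, fun ⟨ij, hij, h1, h2⟩ => p.not_mem ⟨ij, hij, hxR _ h1, hxR _ h2⟩⟩
      have hqV : proj q ∈ V := hNV q hNR.1
      have h0 := hfC (proj q) ⟨hqV, Curve.proj_mem_carrier.2 hx⟩
      rw [(hAB q hqV).2, div_eq_zero_iff, or_iff_left (hAB q hqV).1] at h0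
      rw [map_mul, show eval x A = 0 from h0, zero_mul]
  refine (C.prime_equation.dvd_or_dvd hdvd).resolve_right ?_
  rintro ⟨K, hK⟩
  have := congrArg (eval p.coord) hK
  rw [map_mul, map_mul, hpC, zero_mul] at this
  exact mul_ne_zero hN hRp this

/-- The Laurent monomial is a unit on the chart, so generation of the ideal of `C` reduces to
divisibility of numerators by the prime `C.equation`. -/
theorem isLocalEquation_chart {p : Pt} {C : Curve} {e : Fin 6 → ℤ}
    (he : ∑ i, e i • weight i = -C.cls) (hp : ∀ i, e i ≠ 0 → p.coord i ≠ 0) :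
    IsLocalEquation (chart p) C (descend fun q => eval q.coord C.equation * laurent e q) := by
  have hC := C.isWeightedHomogeneous_equation
  refine ⟨isRegularOn_descend_eval_mul_laurent hC he hp, ?_, ?_⟩
  · rintro x ⟨-, q, rfl, hq⟩
    rw [descend_eval_mul_laurent hC he, hq, zero_mul]
  intro x hx V hV hxV f hf hfC
  obtain ⟨p₀, rfl⟩ := proj_surjective x
  obtain ⟨A, B, hAB⟩ := hf.exists_quotient hV
  obtain ⟨P, Q, hPQ⟩ := exists_laurent_eq_quotient e
  have hQ : ∀ q, proj q ∈ chart p → eval q.coord Q ≠ 0 := fun q hq =>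
    (hPQ q).2 fun i hi => proj_mem_chart.1 hq i (hp i hi)
  have hL : ∀ q, proj q ∈ chart p → laurent e q ≠ 0 := fun q hq =>
    laurent_ne_zero fun i hi => proj_mem_chart.1 hq i (hp i hi)
  have hP : ∀ q, proj q ∈ chart p → eval q.coord P ≠ 0 := fun q hq h0 =>
    hL q hq (by rw [(hPQ q).1, h0, zero_div])
  by_cases hpC : eval p₀.coord C.equation = 0
  · obtain ⟨K, rfl⟩ := C.equation_dvd_of_vanishing hV hfC hAB hxV hpC
    have hinv : ∀ (g : Torus) (q : Pt), proj q ∈ chart p ∩ V →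
        eval (g • q).coord K / (eval (g • q).coord B * laurent e (g • q)) =
          eval q.coord K / (eval q.coord B * laurent e q) := by
      intro g q hq
      obtain ⟨N, hN, hNV⟩ := exists_principal_open_subset_preimage hV hxV
      -- On `C` itself the quotient of `f` by the local equation reads `0 / 0`. Invariance is
      -- therefore proved as a polynomial identity, by cancelling `C.equation` off the curve and
      -- using density.
      have key : MvPolynomial.C (character C.cls g : ℂ) * twist g K * B = K * twist g B := by
        refine eq_of_eval_eq (N := C.equation * N)
          (mul_ne_zero C.equation_ne_zero (ne_zero_of_eval_ne_zero hN)) fun q' hq' => ?_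
        rw [map_mul, mul_ne_zero_iff] at hq'
        have h1 := hAB q' (hNV q' hq'.2)
        have h2 := hAB (g • q') (by rw [proj_smul]; exact hNV q' hq'.2)
        rw [proj_smul, h1.2, div_eq_div_iff h1.1 h2.1] at h2
        have h3 := h2.2
        simp only [map_mul, eval_C, eval_twist] at h3 ⊢
        rw [eval_smul_of_isWeightedHomogeneous hC] at h3
        apply mul_left_cancel₀ hq'.1
        linear_combination -h3
      have h1 := hAB q hq.2
      have h2 := hAB (g • q) (by rw [proj_smul]; exact hq.2)
      have h3 := congrArg (eval q.coord) key
      simp only [map_mul, eval_C, eval_twist] at h3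
      have hLq := hL q hq.1
      rw [laurent_smul, he, character_neg, Units.val_inv_eq_inv_val,
        div_eq_div_iff (mul_ne_zero h2.1 (mul_ne_zero (inv_ne_zero (Units.ne_zero _)) hLq))
          (mul_ne_zero h1.1 hLq)]
      have hχ := Units.ne_zero (character C.cls g)
      field_simp
      linear_combination h3
    refine ⟨chart p ∩ V, (isOpen_chart p).inter hV, ⟨hx, hxV⟩, subset_rfl,
      descend fun q => eval q.coord K / (eval q.coord B * laurent e q), ?_, ?_⟩
    · refine isRegularOn_of_quotient (K * Q) (B * P) fun q hq => ⟨?_, ?_⟩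
      · rw [map_mul]
        exact mul_ne_zero (hAB q hq.2).1 (hP q hq.1)
      · have h1 := hP q hq.1
        have h2 := hQ q hq.1
        have h3 := (hAB q hq.2).1
        rw [descend_proj fun g => hinv g q hq, (hPQ q).1, map_mul, map_mul]
        field_simp
    · intro y hy
      obtain ⟨q, rfl⟩ := proj_surjective y
      have h1 := hL q hy.1
      have h3 := (hAB q hy.2).1
      rw [descend_eval_mul_laurent hC he, descend_proj fun g => hinv g q hy, (hAB q hy.2).2,
        map_mul]
      field_simp
  -- Away from `C` the local equation is invertible, and division by it suffices.
  · have hopen : IsOpen (C.carrierᶜ) :=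
      isOpen_of_preimage_eq C.equation fun q => not_congr Curve.proj_mem_carrier
    refine ⟨chart p ∩ V ∩ C.carrierᶜ, ((isOpen_chart p).inter hV).inter hopen,
      ⟨⟨hx, hxV⟩, fun h => hpC (Curve.proj_mem_carrier.1 h)⟩, Set.inter_subset_left,
      fun y => f y / descend (fun q => eval q.coord C.equation * laurent e q) y, ?_, ?_⟩
    · refine isRegularOn_of_quotient (A * Q) (B * (C.equation * P)) fun q hq => ?_
      have hq3 : eval q.coord C.equation ≠ 0 := fun h => hq.2 (Curve.proj_mem_carrier.2 h)
      have h1 := hP q hq.1.1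
      have h2 := hQ q hq.1.1
      have h3 := (hAB q hq.1.2).1
      refine ⟨by simp [h1, h3, hq3], ?_⟩
      rw [descend_eval_mul_laurent hC he, (hAB q hq.1.2).2, (hPQ q).1]
      simp only [map_mul]
      field_simp
    · intro y hy
      obtain ⟨q, rfl⟩ := proj_surjective y
      have hq3 : eval q.coord C.equation ≠ 0 := fun h => hy.2 (Curve.proj_mem_carrier.2 h)
      change f (proj q) = _ * (f (proj q) / _)
      rw [descend_eval_mul_laurent hC he,
        mul_div_cancel₀ _ (mul_ne_zero hq3 (hL q hy.1.1))]

/-! ### Sections as homogeneous polynomials -/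

/-- The value of the equation of a divisor. -/
noncomputable def eqProd (D : Divisor) (q : Pt) : ℂ := ∏ C, eval q.coord C.equation ^ D C

theorem eqProd_smul (D : Divisor) (g : Torus) (q : Pt) :
    eqProd D (g • q) = character D.cls g * eqProd D q := by
  rw [Divisor.cls, character_sum]
  simp only [eqProd, eval_smul_of_isWeightedHomogeneous (Curve.isWeightedHomogeneous_equation _),
    mul_zpow, Finset.prod_mul_distrib]
  simp

theorem eqProd_ne_zero (D : Divisor) {q : Pt} (hq : proj q ∈ offCurves) : eqProd D q ≠ 0 :=
  Finset.prod_ne_zero_iff.2 fun C _ => zpow_ne_zero _ (proj_mem_offCurves.1 hq C)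

open Classical in
/-- The rational function on `𝔹₃` with numerator `F` and denominator the equation of `D`. -/
noncomputable def quotientFun (D : Divisor) (F : Poly) (x : B3) : ℂ :=
  if x ∈ offCurves then descend (fun q => eval q.coord F / eqProd D q) x else 0

theorem quotientFun_proj {D : Divisor} {F : Poly}
    (hF : IsWeightedHomogeneous weight F D.cls) {q : Pt} (hq : proj q ∈ offCurves) : quotientFun D F (proj q) = eval q.coord F / eqProd D q := by
  rw [quotientFun, if_pos hq]
  refine descend_proj fun g => ?_
  rw [eval_smul_of_isWeightedHomogeneous hF, eqProd_smul, mul_div_mul_left _ _ (Units.ne_zero _)]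

/-- At each point there are Laurent monomials, in coordinates that do not vanish there, which make
the equations of the curves invariant. -/
theorem exists_curve_exponents (p : Pt) : ∃ e : Curve → Fin 6 → ℤ,
    (∀ C, ∑ i, e C i • weight i = -C.cls) ∧ (∀ C i, e C i ≠ 0 → p.coord i ≠ 0) := by
  choose e he using fun C : Curve => exists_exponent p (-C.cls)
  exact ⟨e, fun C => (he C).1, fun C => (he C).2⟩

theorem prod_localEquation {p : Pt} {e : Curve → Fin 6 → ℤ}
    (he : ∀ C, ∑ i, e C i • weight i = -C.cls) (hp : ∀ C i, e C i ≠ 0 → p.coord i ≠ 0)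
    (D : Divisor) {q : Pt} (hq : proj q ∈ chart p) :
    ∏ C, descend (fun q => eval q.coord C.equation * laurent (e C) q) (proj q) ^ D C =
      eqProd D q * laurent (∑ C, D C • e C) q := by
  rw [laurent_sum _ _ _ fun C _ i hi => proj_mem_chart.1 hq i (hp C i hi), eqProd,
    ← Finset.prod_mul_distrib]
  refine Finset.prod_congr rfl fun C _ => ?_
  rw [descend_eval_mul_laurent C.isWeightedHomogeneous_equation (he C), mul_zpow]

theorem sum_exponent_ne_zero {p : Pt} {e : Curve → Fin 6 → ℤ}
    (hp : ∀ C i, e C i ≠ 0 → p.coord i ≠ 0) (D : Divisor) (i : Fin 6)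
    (hi : (∑ C, D C • e C) i ≠ 0) : p.coord i ≠ 0 := by
  rw [Finset.sum_apply] at hi
  obtain ⟨C, -, hC⟩ := Finset.exists_ne_zero_of_sum_ne_zero hi
  exact hp C i fun h => hC (by simp [h])

theorem sum_exponent_weight {e : Curve → Fin 6 → ℤ}
    (he : ∀ C, ∑ i, e C i • weight i = -C.cls) (D : Divisor) :
    ∑ i, (∑ C, D C • e C) i • weight i = -D.cls := by
  have : ∀ i, (∑ C, D C • e C) i • weight i = ∑ C, D C • e C i • weight i := fun i => by
    rw [Finset.sum_apply, Finset.sum_smul]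
    exact Finset.sum_congr rfl fun C _ => by rw [Pi.smul_apply, smul_assoc]
  rw [Finset.sum_congr rfl fun i _ => this i, Finset.sum_comm, Divisor.cls,
    ← Finset.sum_neg_distrib]
  exact Finset.sum_congr rfl fun C _ => by rw [← Finset.smul_sum, he, smul_neg]

theorem zpow_eq_pow_mul_pow {u v : ℂ} (h : u * v = 1) (n : ℤ) :
    u ^ n = u ^ n.toNat * v ^ (-n).toNat := by
  rw [zpow_eq_pow_div_pow, eq_inv_of_mul_eq_one_right h, inv_pow, div_eq_mul_inv]

/-- Arbitrary local equations differ from the chart equations by units, since each divides the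
other; it then suffices that `F` times a Laurent monomial is regular on the chart. -/
theorem quotientFun_mem_sections {D : Divisor} {F : Poly}
    (hF : IsWeightedHomogeneous weight F D.cls) : quotientFun D F ∈ sections D := by
  refine ⟨fun x hx => if_neg hx, ?_, ?_⟩
  · refine isRegularOn_of_quotient (F * ∏ C : Curve, C.equation ^ (-D C).toNat)
      (∏ C : Curve, C.equation ^ (D C).toNat) fun q hq => ⟨?_, ?_⟩
    · rw [map_prod]
      refine Finset.prod_ne_zero_iff.2 fun C _ => ?_
      rw [map_pow]
      exact pow_ne_zero _ (proj_mem_offCurves.1 hq C)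
    · rw [quotientFun_proj hF hq, eqProd]
      simp only [map_mul, map_prod, map_pow]
      rw [Finset.prod_congr rfl fun C _ => zpow_eq_pow_div_pow _ (D C), Finset.prod_div_distrib,
        div_div_eq_mul_div]
  · intro V g hV hg x hx
    obtain ⟨p, rfl⟩ := proj_surjective x
    obtain ⟨e, he, hp⟩ := exists_curve_exponents p
    have hloc := fun C => isLocalEquation_chart (he C) (hp C)
    have hpc := proj_mem_chart_self p
    choose V₁ hV₁ hx₁ hsub₁ u hu hgu using fun C =>
      (hloc C).2.2 (proj p) hpc V hV hx (g C) (hg C).1 (hg C).2.1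
    choose V₂ hV₂ hx₂ hsub₂ v hv hgv using fun C =>
      (hg C).2.2 (proj p) hx (chart p) (isOpen_chart p) hpc _ (hloc C).1 (hloc C).2.1
    refine ⟨⋂ C, V₁ C ∩ V₂ C, isOpen_iInter_of_finite fun C => (hV₁ C).inter (hV₂ C),
      Set.mem_iInter.2 fun C => ⟨hx₁ C, hx₂ C⟩,
      fun y hy => (hsub₁ .H (Set.mem_iInter.1 hy .H).1).2,
      -- The unit `u C` has inverse `v C` off the curves, so `u C ^ D C` is written with natural
      -- exponents and stays regular.
      (descend fun q => eval q.coord F * laurent (∑ C, D C • e C) q) *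
        ∏ C, u C ^ (D C).toNat * v C ^ (-D C).toNat, ?_, ?_⟩
    · refine IsRegularOn.mul ?_ (IsRegularOn.prod _ fun C => ?_)
      · exact (isRegularOn_descend_eval_mul_laurent hF (sum_exponent_weight he D)
          (sum_exponent_ne_zero hp D)).mono
          fun y hy => (hsub₁ .H (Set.mem_iInter.1 hy .H).1).1
      · exact (((hu C).pow _).mono fun y hy => (Set.mem_iInter.1 hy C).1).mul
          (((hv C).pow _).mono fun y hy => (Set.mem_iInter.1 hy C).2)
    · rintro y ⟨hy, hyoff⟩
      obtain ⟨q, rfl⟩ := proj_surjective y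
      have hqc : proj q ∈ chart p := (hsub₁ .H (Set.mem_iInter.1 hy .H).1).1
      have huv : ∀ C, u C (proj q) * v C (proj q) = 1 := by
        intro C
        have h1 := hgu C _ (Set.mem_iInter.1 hy C).1
        have h2 := hgv C _ (Set.mem_iInter.1 hy C).2
        rw [h1, descend_eval_mul_laurent C.isWeightedHomogeneous_equation (he C), mul_assoc] at h2
        exact (mul_eq_left₀ (mul_ne_zero (proj_mem_offCurves.1 hyoff C)
          (laurent_ne_zero fun i hi => proj_mem_chart.1 hqc i (hp C i hi)))).1 h2.symm
      have h3 : ∏ C, g C (proj q) ^ D C = eqProd D q * laurent (∑ C, D C • e C) q *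
          ∏ C, u C (proj q) ^ (D C).toNat * v C (proj q) ^ (-D C).toNat := by
        rw [← prod_localEquation he hp D hqc, ← Finset.prod_mul_distrib]
        refine Finset.prod_congr rfl fun C _ => ?_
        rw [hgu C _ (Set.mem_iInter.1 hy C).1, mul_zpow, zpow_eq_pow_mul_pow (huv C)]
      have h4 := eqProd_ne_zero D hyoff
      rw [h3, quotientFun_proj hF hyoff, Pi.mul_apply,
        descend_eval_mul_laurent hF (sum_exponent_weight he D)]
      simp only [Finset.prod_apply, Pi.mul_apply, Pi.pow_apply]
      field_simp

theorem exists_eq_quotientFun {D : Divisor} {f : B3 → ℂ} (hf : f ∈ sections D) :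
    ∃ F : Poly, IsWeightedHomogeneous weight F D.cls ∧ f = quotientFun D F := by
  obtain ⟨hf0, -, hf⟩ := hf
  set T : Poly := ∏ C : Curve, C.equation with hTdef
  have hT : T ≠ 0 := Finset.prod_ne_zero_iff.2 fun C _ => C.equation_ne_zero
  have hToff : ∀ q : Pt, eval q.coord T ≠ 0 ↔ proj q ∈ offCurves := fun q => by
    rw [hTdef, map_prod, Finset.prod_ne_zero_iff, proj_mem_offCurves]
    simp
  -- The section condition for the chart equations gives `f · eqProd D` locally as a regular
  -- function times an inverse Laurent monomial.
  obtain ⟨A, B, hAB⟩ := exists_quotient_of_locally_quotient Set.univ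
    (fun q => f (proj q) * eqProd D q) hT (by
      intro p _
      obtain ⟨e, he, hp⟩ := exists_curve_exponents p
      obtain ⟨V, hV, hpV, hVc, k, hk, hkf⟩ := hf (chart p) _ (isOpen_chart p)
        (fun C => isLocalEquation_chart (he C) (hp C)) (proj p) (proj_mem_chart_self p)
      obtain ⟨N, hN, hNV⟩ := exists_principal_open_subset_preimage hV hpV
      obtain ⟨F, G, hFG⟩ := hk.exists_quotient hV
      obtain ⟨P, Q, hPQ⟩ := exists_laurent_eq_quotient (-∑ C, D C • e C)
      have hQ : ∀ q, proj q ∈ chart p → eval q.coord Q ≠ 0 := fun q hq =>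
        (hPQ q).2 fun i hi => proj_mem_chart.1 hq i
          (sum_exponent_ne_zero hp D i (by simpa using hi))
      refine ⟨F * P * N, G * Q * N, ?_, fun q hq hqT => ?_⟩
      · simp [hN, hQ p (proj_mem_chart_self p), (hFG p hpV).1]
      · simp only [map_mul, mul_ne_zero_iff] at hq
        have hqV := hNV q hq.2
        have h1 := hkf (proj q) ⟨hqV, (hToff q).1 hqT⟩
        rw [(hFG q hqV).2, prod_localEquation he hp D (hVc hqV), ← mul_assoc] at h1
        have hL : laurent (∑ C, D C • e C) q ≠ 0 := laurent_ne_zero fun i hi =>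
          proj_mem_chart.1 (hVc hqV) i (sum_exponent_ne_zero hp D i hi)
        have h2 := (hPQ q).1
        rw [laurent_neg] at h2
        simp only [map_mul]
        rw [mul_div_mul_right _ _ hq.2, mul_div_mul_comm, h1, ← h2, mul_assoc _ _ (_⁻¹),
          mul_inv_cancel₀ hL, mul_one])
  obtain ⟨b, hb, rfl⟩ := isUnit_iff_eq_C_of_isReduced.1
    (isUnit_of_forall_eval_ne_zero fun p => (hAB p trivial).1)
  have hA : ∀ q, proj q ∈ offCurves →
      f (proj q) * eqProd D q = eval q.coord (MvPolynomial.C b⁻¹ * A) := by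
    intro q hq
    rw [(hAB q trivial).2 ((hToff q).2 hq), map_mul, eval_C, eval_C, div_eq_inv_mul]
  -- Since `f` is invariant, the polynomial transforms by the same character as `eqProd D`.
  have hhom : IsWeightedHomogeneous weight (MvPolynomial.C b⁻¹ * A) D.cls := by
    refine isWeightedHomogeneous_iff_twist.2 fun g => eq_of_eval_eq hT fun q hq => ?_
    rw [hToff] at hq
    rw [eval_twist, ← hA (g • q) (by rwa [proj_smul]), proj_smul, eqProd_smul, map_mul, eval_C,
      ← hA q hq]
    ring
  refine ⟨_, hhom, funext fun x => ?_⟩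
  by_cases hx : x ∈ offCurves
  · obtain ⟨q, rfl⟩ := proj_surjective x
    rw [quotientFun_proj hhom hx, ← hA q hx, mul_div_cancel_right₀ _ (eqProd_ne_zero D hx)]
  · rw [hf0 x hx, quotientFun, if_neg hx]

/-- The map from homogeneous polynomials to sections. -/
noncomputable def toSections (D : Divisor) :
    ↥(weightedHomogeneousSubmodule ℂ weight D.cls) →ₗ[ℂ] ↥(sections D) where
  toFun F := ⟨quotientFun D F.1, quotientFun_mem_sections F.2⟩
  map_add' F G := Subtype.ext <| funext fun x => by
    simp only [quotientFun, descend, Submodule.coe_add, map_add, add_div, Pi.add_apply]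
    split_ifs <;> simp
  map_smul' c F := Subtype.ext <| funext fun x => by
    simp only [quotientFun, descend, Submodule.coe_smul, smul_eval, mul_div_assoc, Pi.smul_apply,
      RingHom.id_apply, smul_eq_mul]
    split_ifs <;> simp

theorem toSections_bijective (D : Divisor) : Function.Bijective (toSections D) := by
  constructor
  · intro F G h
    have hT : (∏ C : Curve, C.equation) ≠ 0 :=
      Finset.prod_ne_zero_iff.2 fun C _ => C.equation_ne_zero
    refine Subtype.ext (eq_of_eval_eq hT fun q hq => ?_)
    rw [map_prod, Finset.prod_ne_zero_iff] at hq
    have hq' : proj q ∈ offCurves := proj_mem_offCurves.2 fun C => hq C (Finset.mem_univ C)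
    have h1 : quotientFun D F.1 (proj q) = quotientFun D G.1 (proj q) :=
      congrFun (congrArg Subtype.val h) (proj q)
    rw [quotientFun_proj F.2 hq', quotientFun_proj G.2 hq'] at h1
    exact (div_left_inj' (eqProd_ne_zero D hq')).1 h1
  · rintro ⟨f, hf⟩
    obtain ⟨F, hF, rfl⟩ := exists_eq_quotientFun hf
    exact ⟨⟨F, hF⟩, rfl⟩

/-- `H⁰(𝔹₃, O(D))` is the space of homogeneous polynomials whose weight is the class of `D`. -/
noncomputable def sectionsEquiv (D : Divisor) :
    ↥(weightedHomogeneousSubmodule ℂ weight D.cls) ≃ₗ[ℂ] ↥(sections D) :=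
  LinearEquiv.ofBijective (toSections D) (toSections_bijective D)

theorem h0_eq_card (D : Divisor) :
    h0 D = Nat.card {d : Fin 6 →₀ ℕ | Finsupp.weight weight d = D.cls} := by
  rw [h0, ← (sectionsEquiv D).finrank_eq, weightedHomogeneousSubmodule_eq_finsupp_supported]
  exact Module.finrank_eq_nat_card_basis
    (basisRestrictSupport ℂ {d : Fin 6 →₀ ℕ | Finsupp.weight weight d = D.cls})

end DelPezzo

namespace DelPezzo

/-! ### Counting monomials -/

/-- A difference of two triangular numbers; with truncated subtraction it stays valid for `n > c`,
where the sum is the full triangle. -/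
theorem two_mul_sum_range_sub (c n : ℕ) :
    2 * ∑ i ∈ Finset.range n, (c - i) + (c - n) * (c - n + 1) = c * (c + 1) := by
  induction n with
  | zero => simp
  | succ n ih =>
    rw [← ih, Finset.sum_range_succ]
    rcases Nat.lt_or_ge n c with h | h
    · obtain ⟨k, rfl⟩ := Nat.exists_eq_add_of_lt h
      rw [show n + k + 1 - (n + 1) = k by omega, show n + k + 1 - n = k + 1 by omega]
      ring
    · rw [Nat.sub_eq_zero_of_le h, Nat.sub_eq_zero_of_le (h.trans n.le_succ)]
      ring

theorem weight_eq_iff (x : Fin 6 →₀ ℕ) (a b c d : ℕ) :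
    Finsupp.weight weight x = ![(a : ℤ), b, c, d] ↔ x 0 + x 1 + x 2 = a ∧
      b + x 1 + x 3 = a ∧ c + x 0 + x 4 = a ∧ d + x 2 + x 5 = a := by
  rw [Finsupp.weight_apply, Finsupp.sum_fintype _ _ (by simp), funext_iff, Fin.forall_fin_succ,
    Fin.forall_fin_succ, Fin.forall_fin_succ, Fin.forall_fin_one]
  simp [Fin.sum_univ_six, weight]
  omega

/-- The number of monomials of weight `(a, b, c, d)`, in the range where it is quadratic. -/
theorem card_monomials (a b c d : ℕ) (hc : c ≤ a) (hd : d ≤ a) (hbc : b + c ≤ a + 1)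
    (hcd : c + d ≤ a + 1) (hbd : b + d ≤ a + 1) :
    2 * Nat.card {x : Fin 6 →₀ ℕ | Finsupp.weight weight x = ![(a : ℤ), b, c, d]} +
      (b * (b + 1) + c * (c + 1) + d * (d + 1)) = (a + 1) * (a + 2) := by
  -- The exponents `i` of `X` and `j` of `Y` determine the rest; nonnegativity of the other four
  -- gives the bounds.
  have hcard : Nat.card {x : Fin 6 →₀ ℕ | Finsupp.weight weight x = ![(a : ℤ), b, c, d]} =
      ((Finset.range (a - c + 1)).sigma fun i =>
        Finset.Ico (d - i) (a + 1 - max i b)).card := by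
    rw [Nat.card_coe_set_eq, ← Set.ncard_coe_finset]
    refine Set.ncard_congr (fun x _ => ⟨x 0, x 1⟩) ?_ ?_ ?_
    · intro x hx
      have hx := (weight_eq_iff x a b c d).1 hx
      simp only [Finset.coe_sigma, Set.mem_sigma_iff, Finset.mem_coe, Finset.mem_range,
        Finset.mem_Ico]
      omega
    · intro x y hx hy hxy
      have hx := (weight_eq_iff x a b c d).1 hx
      have hy := (weight_eq_iff y a b c d).1 hy
      simp only [Sigma.mk.injEq, heq_eq_eq] at hxy
      ext i
      fin_cases i <;> simp <;> omega
    · rintro ⟨i, j⟩ hij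
      simp only [Finset.coe_sigma, Set.mem_sigma_iff, Finset.mem_coe, Finset.mem_range,
        Finset.mem_Ico] at hij
      refine ⟨Finsupp.equivFunOnFinite.symm
        ![i, j, a - i - j, a - b - j, a - c - i, i + j - d], ?_, ?_⟩
      · refine (weight_eq_iff _ a b c d).2 ?_
        simp
        omega
      · simp
  -- A full row of the degree `a` triangle has `a + 1 - i` points; two corners remove `d - i` and `b
  -- - i` of them. The third corner consists of the rows `i > a - c`.
  have hterm : ∀ i ∈ Finset.range (a - c + 1),
      (Finset.Ico (d - i) (a + 1 - max i b)).card + (d - i) + (b - i) = a + 1 - i := by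
    intro i hi
    rw [Finset.mem_range] at hi
    rw [Nat.card_Ico]
    omega
  have hsum := Finset.sum_congr rfl hterm
  rw [Finset.sum_add_distrib, Finset.sum_add_distrib, ← Finset.card_sigma, ← hcard] at hsum
  have h1 := two_mul_sum_range_sub (a + 1) (a - c + 1)
  have h2 := two_mul_sum_range_sub b (a - c + 1)
  have h3 := two_mul_sum_range_sub d (a - c + 1)
  rw [show a + 1 - (a - c + 1) = c by omega] at h1
  -- Here `b + c ≤ a + 1` ensures that the corner of size `b` ends before the omitted rows; the next
  -- line does the same for `d`.
  rw [show b - (a - c + 1) = 0 by omega] at h2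
  rw [show d - (a - c + 1) = 0 by omega] at h3
  linarith

theorem theta_pow_six : theta ^ 6 = 1 := by
  decide

/-- The first six terms sum to the anticanonical class, and the later ones repeat with period six.
-/
theorem classD_six_add (n : ℕ) : classD (6 + n) = ![3, 1, 1, 1] + classD n := by
  have h6 : (∑ i ∈ Finset.range 6, theta ^ i).mulVec Curve.L1.cls = ![3, 1, 1, 1] := by
    decide
  rw [classD, Finset.sum_range_add, Matrix.add_mulVec, h6, classD]
  simp only [pow_add, theta_pow_six, one_mul]

theorem classD_six_mul_add (m r : ℕ) :
    classD (6 * m + r) = (m : ℤ) • ![3, 1, 1, 1] + classD r := by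
  induction m with
  | zero => simp
  | succ m ih =>
    rw [show 6 * (m + 1) + r = 6 + (6 * m + r) by ring, classD_six_add, ih, Nat.cast_succ,
      add_smul, one_smul]
    abel

/-- The values of `h⁰(D_n)`. -/
theorem h0_of_cls_eq {D : Divisor} {m r : ℕ} (hr : r ≤ 5) (hD : D.cls = classD (6 * m + r)) :
    h0 D = if r = 0 then 3 * m ^ 2 + 3 * m + 1 else (m + 1) * (3 * m + r) := by
  -- The inequalities survive adding `m • (3, 1, 1, 1)`: the left sides grow by at most `2m`, the
  -- right sides by `3m`. Only `D_0, …, D_5` need checking.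
  have key : ∀ a b c d : ℕ, classD r = ![(a : ℤ), b, c, d] →
      c ≤ a → d ≤ a → b + c ≤ a + 1 → c + d ≤ a + 1 → b + d ≤ a + 1 →
      2 * h0 D + ((m + b) * (m + b + 1) + (m + c) * (m + c + 1) + (m + d) * (m + d + 1)) =
        (3 * m + a + 1) * (3 * m + a + 2) := by
    intro a b c d hcls h1 h2 h3 h4 h5
    have hw : D.cls = ![((3 * m + a : ℕ) : ℤ), (m + b : ℕ), (m + c : ℕ), (m + d : ℕ)] := by
      rw [hD, classD_six_mul_add, hcls]
      simp [mul_comm]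
    rw [h0_eq_card, hw]
    exact card_monomials _ _ _ _ (by omega) (by omega) (by omega) (by omega) (by omega)
  interval_cases r
  · have := key 0 0 0 0 (by decide) (by simp) (by simp) (by simp) (by simp) (by simp)
    simp only [if_true]
    linarith
  · have := key 1 1 0 1 (by decide) (by simp) (by simp) (by simp) (by simp) (by simp)
    simp
    linarith
  · have := key 1 1 0 0 (by decide) (by simp) (by simp) (by simp) (by simp) (by simp)
    simp
    linarith
  · have := key 2 1 1 1 (by decide) (by simp) (by simp) (by simp) (by simp) (by simp)
    simp
    linarith
  · have := key 2 1 0 1 (by decide) (by simp) (by simp) (by simp) (by simp) (by simp)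
    simp
    linarith
  · have := key 3 2 1 1 (by decide) (by simp) (by simp) (by simp) (by simp) (by simp)
    simp
    linarith

/-! ### The Hilbert series -/

-- Multiplication by the expanded denominator turns the claim into the recurrence in degrees at
-- least `6` and into the six initial values below that.
open PowerSeries in
theorem mk_eq_inv_of_recurrence {a : ℕ → ℚ} (h0 : a 0 = 1) (h1 : a 1 = 1) (h2 : a 2 = 2)
    (h3 : a 3 = 3) (h4 : a 4 = 4) (h5 : a 5 = 5)
    (h : ∀ n, a (n + 6) + a (n + 2) + a (n + 1) = a (n + 5) + a (n + 4) + a n) :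
    PowerSeries.mk a = ((1 - X) * (1 - X ^ 2) * (1 - X ^ 3))⁻¹ := by
  rw [PowerSeries.eq_inv_iff_mul_eq_one (by simp)]
  have hX : ((1 - X) * (1 - X ^ 2) * (1 - X ^ 3) : PowerSeries ℚ) =
      1 - X ^ 1 - X ^ 2 + X ^ 4 + X ^ 5 - X ^ 6 := by ring
  rw [hX]
  ext n
  simp only [mul_add, mul_sub, mul_one, map_add, map_sub, coeff_mul_X_pow', coeff_mk, coeff_one]
  rcases Nat.lt_or_ge n 6 with hn | hn
  · interval_cases n <;> norm_num [h0, h1, h2, h3, h4, h5]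
  · obtain ⟨k, rfl⟩ := Nat.exists_eq_add_of_le' hn
    have := h k
    simp only [show 1 ≤ k + 6 by omega, show 2 ≤ k + 6 by omega, show 4 ≤ k + 6 by omega,
      show 5 ≤ k + 6 by omega, show 6 ≤ k + 6 by omega, show k + 6 ≠ 0 by omega, if_true, if_false,
      show k + 6 - 1 = k + 5 by omega, show k + 6 - 2 = k + 4 by omega,
      show k + 6 - 4 = k + 2 by omega, show k + 6 - 5 = k + 1 by omega, Nat.add_sub_cancel]
    linarith

theorem hilbert_recurrence {a : ℕ → ℕ} (ha : ∀ m r : ℕ, r ≤ 5 →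
      a (6 * m + r) = if r = 0 then 3 * m ^ 2 + 3 * m + 1 else (m + 1) * (3 * m + r)) (n : ℕ) :
    a (n + 6) + a (n + 2) + a (n + 1) = a (n + 5) + a (n + 4) + a n := by
  have h0 := fun m => ha m 0 (by norm_num)
  have h1 := fun m => ha m 1 (by norm_num)
  have h2 := fun m => ha m 2 (by norm_num)
  have h3 := fun m => ha m 3 (by norm_num)
  have h4 := fun m => ha m 4 (by norm_num)
  have h5 := fun m => ha m 5 (by norm_num)
  simp only [if_true, add_zero, one_ne_zero, OfNat.ofNat_ne_zero, if_false] at h0 h1 h2 h3 h4 h5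
  obtain ⟨m, r, hr, rfl⟩ : ∃ m r, r < 6 ∧ n = 6 * m + r :=
    ⟨n / 6, n % 6, Nat.mod_lt _ (by norm_num), (Nat.div_add_mod n 6).symm⟩
  -- The indices `n, …, n + 6` can run past `6m + 5`, so the formulas for the next block are needed
  -- too.
  have e6 := h0 (m + 1)
  have e7 := h1 (m + 1)
  have e8 := h2 (m + 1)
  have e9 := h3 (m + 1)
  have e10 := h4 (m + 1)
  have e11 := h5 (m + 1)
  rw [mul_add] at e6 e7 e8 e9 e10 e11
  interval_cases r <;> simp only [add_assoc, Nat.reduceAdd, Nat.reduceMul, add_zero] at * <;>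
    simp only [h0, h1, h2, h3, h4, h5, e6, e7, e8, e9, e10, e11] <;> ring

end DelPezzo

/-- `D n` is any divisor supported on the seven curves whose class in `Pic 𝔹₃ = ℤ⁴` is `D_n`. -/
theorem mainTheorem5 (D : ℕ → DelPezzo.Divisor) (hD : ∀ n, (D n).cls = DelPezzo.classD n) :
    (∀ m r : ℕ, r ≤ 5 →
      DelPezzo.h0 (D (6 * m + r)) =
        if r = 0 then 3 * m ^ 2 + 3 * m + 1 else (m + 1) * (3 * m + r)) ∧
    PowerSeries.mk (fun n => (DelPezzo.h0 (D n) : ℚ)) =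
      ((1 - PowerSeries.X) * (1 - PowerSeries.X ^ 2) * (1 - PowerSeries.X ^ 3))⁻¹ := by
  have h : ∀ m r : ℕ, r ≤ 5 → DelPezzo.h0 (D (6 * m + r)) =
      if r = 0 then 3 * m ^ 2 + 3 * m + 1 else (m + 1) * (3 * m + r) :=
    fun m r hr => DelPezzo.h0_of_cls_eq hr (hD _)
  have h0 : ∀ r ≤ 5, DelPezzo.h0 (D r) = if r = 0 then 1 else r := fun r hr => by
    simpa using h 0 r hr
  refine ⟨h, DelPezzo.mk_eq_inv_of_recurrence ?_ ?_ ?_ ?_ ?_ ?_ fun n => ?_⟩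
  · simp [h0 0]
  · simp [h0 1]
  · simp [h0 2]
  · simp [h0 3]
  · simp [h0 4]
  · simp [h0 5]
  · exact_mod_cast DelPezzo.hilbert_recurrence (a := fun n => DelPezzo.h0 (D n)) h n
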